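/- Let $\hbar>0$, let $\mu$ be a Borel probability measure on $\mathbb R$ that is not a Dirac mass (for instance $d\mu=\tilde g(p)\,dp$ with a probability density $\tilde g$), and put $g(\xi)=\int e^{ip\xi/\hbar}\,d\mu(p)$. Let $\mathcal H=L^2(\mathbb R)$, let $\mathcal T_1(\mathcal H)$ be the space of trace class operators on $\mathcal H$, let $X$ be the position operator, and let $$\Delta_g(\rho)=\int e^{ipX/\hbar}\,\rho\,e^{-ipX/\hbar}\,d\mu(p),\qquad\text{i.e.}\quad \Delta_g:\rho(x,y)\mapsto g(x-y)\rho(x,y),$$ be the associated dephasing channel on $\mathcal T_1(\mathcal H)$. The $l_2$ $g$-dephasing loss is $C_2^g(\rho)=\|\rho\|_2^2-\|\Delta_g(\rho)\|_2^2$, with $\|\cdot\|_2$ the Hilbert--Schmidt norm. A linear map $\Lambda$ on $\mathcal T_1(\mathcal H)$ is dephasing-covariant if $\Lambda\circ\Delta_g=\Delta_g\circ\Lambda$, and $\mathcal{DIO}_g$ is the class of completely positive trace preserving dephasing-covariant maps. A functional $C$ is strongly monotone under $\mathcal{DIO}_g$ if $$C(\rho)\ge\sum_k p_k\,C(\rho_k),\qquad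 p_k=\operatorname{Tr}\Lambda_k(\rho),\quad \rho_k=\Lambda_k(\rho)/p_k,$$ for every state $\rho$ and every finite instrument $(\Lambda_k)_k$ with completely positive dephasing-covariant branches and trace preserving sum (terms with $p_k=0$ are read as $0$). Proposition. $C_2^g$ is not strongly monotone under $\mathcal{DIO}_g$. Explicitly, let $\phi\in L^2(\mathbb R)$ be normalized and vanish almost everywhere outside a bounded measurable set $C$ (for instance its support), and let $a,b\in\mathbb R$ be such that $A=C+a$ and $B=C+b$ are disjoint. Let $(V_x\psi)(s)=\psi(s-x)$, let $P_S$ be multiplication by the indicator function of $S$, and let $\phi_x=V_x\phi$. Put $$K_A=V_{-a}P_A,\quad K_B=V_{-b}P_B,\quad K_0=P_{(A\cup B)^c},\qquad \Lambda_j(\rho)=K_j\rho K_j^\dagger,\qquad \rho=\tfrac12|\phi_a\rangle\langle\phi_a|+\tfrac12|\phi_b\rangle\langle\phi_b|.$$ Then $\sum_jK_j^\dagger K_j=\mathbb 1$, the $\Lambda_j$ are completely positive and dephasing-covariant with $\sum_j\Lambda_j\in\mathcal{DIO}_g$, $\rho$ is a state, $p_A=p_B=\tfrac12$, $p_0=0$,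 $\rho_A=\rho_B=|\phi\rangle\langle\phi|$, $$\sum_j p_j\,C_2^g(\rho_j)=C_2^g(|\phi\rangle\langle\phi|),\qquad C_2^g(\rho)=\tfrac12\,C_2^g(|\phi\rangle\langle\phi|),$$ and therefore $\sum_jp_jC_2^g(\rho_j)>C_2^g(\rho)$ whenever $C_2^g(|\phi\rangle\langle\phi|)>0$. Data $(\phi,C,a,b)$ as above with $C_2^g(|\phi\rangle\langle\phi|)>0$ exist. -/

import Mathlib

open MeasureTheory InnerProductSpace
open scoped ENNReal ComplexOrder

noncomputable section

namespace PositionCoherence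

/-- The space `L²(ℝ)` of square-integrable wave functions. -/
abbrev H : Type := Lp ℂ 2 (volume : Measure ℝ)

/-! ### Trace class operators, trace, Hilbert-Schmidt norm -/

/-- `T` is trace class (equivalently, on a Hilbert space, nuclear): it is a sum of rank-one
operators `|x n⟩⟨y n|` with `∑ ‖x n‖ ‖y n‖ < ∞`. -/
def IsTraceClass (T : H →L[ℂ] H) : Prop :=
  ∃ x y : ℕ → H, Summable (fun n => ‖x n‖ * ‖y n‖) ∧ HasSum (fun n => rankOne ℂ (x n) (y n)) T

/-- A nuclear sum over an arbitrary index type can be rearranged into a sequence. -/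
theorem isTraceClass_of_hasSum {ι : Type*} {T : H →L[ℂ] H} (x y : ι → H)
    (hs : Summable (fun i => ‖x i‖ * ‖y i‖))
    (hT : HasSum (fun i => rankOne ℂ (x i) (y i)) T) : IsTraceClass T := by
  have hc : (Function.support fun i => ‖x i‖ * ‖y i‖).Countable := hs.countable_support
  set S := Function.support fun i => ‖x i‖ * ‖y i‖ with hS
  have : Countable S := hc
  obtain ⟨e, he⟩ := exists_injective_nat S
  have hs' : Summable (fun i : S => ‖x i‖ * ‖y i‖) := hs.subtype S
  have hT' : HasSum (fun i : S => rankOne ℂ (x i) (y i)) T := by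
    have hsub : Function.support (fun i => rankOne ℂ (x i) (y i)) ⊆ S := by
      intro i hi
      rw [hS, Function.mem_support, ← norm_rankOne (𝕜 := ℂ)]
      exact norm_ne_zero_iff.mpr hi
    exact (hasSum_subtype_iff_of_support_subset
      (f := fun i => rankOne ℂ (x i) (y i)) hsub).mpr hT
  refine ⟨Function.extend e (fun i : S => x i) 0, Function.extend e (fun i : S => y i) 0, ?_, ?_⟩
  · have h := (hasSum_extend_zero he).mpr hs'.hasSum
    refine h.summable.congr fun n => ?_
    by_cases hn : ∃ i, e i = n
    · obtain ⟨i, rfl⟩ := hn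
      simp [he.extend_apply]
    · simp [Function.extend_apply' _ _ _ hn]
  · have h := (hasSum_extend_zero he).mpr hT'
    convert h using 2 with n
    by_cases hn : ∃ i, e i = n
    · obtain ⟨i, rfl⟩ := hn
      simp [he.extend_apply]
    · simp [Function.extend_apply' _ _ _ hn]

/-- The space `𝒯₁(H)` of trace class operators. -/
def TraceClass : Submodule ℂ (H →L[ℂ] H) where
  carrier := {T | IsTraceClass T}
  zero_mem' := ⟨0, 0, by simp, by simp⟩
  add_mem' := by
    rintro S T ⟨x, y, h, hS⟩ ⟨x', y', h', hT⟩
    refine isTraceClass_of_hasSum (Sum.elim x x') (Sum.elim y y') ?_ ?_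
    · exact (h.hasSum.sum (f := fun i => ‖Sum.elim x x' i‖ * ‖Sum.elim y y' i‖) h'.hasSum).summable
    · exact HasSum.sum (f := fun i => rankOne ℂ (Sum.elim x x' i) (Sum.elim y y' i)) hS hT
  smul_mem' := by
    rintro c T ⟨x, y, h, hT⟩
    refine ⟨fun n => c • x n, y, ?_, ?_⟩
    · simpa [norm_smul, mul_assoc] using h.mul_left ‖c‖
    · simpa using hT.const_smul c

/-- The index set of a fixed orthonormal (Hilbert) basis of `L²(ℝ)`. -/
def basisIndex : Set H := (exists_hilbertBasis ℂ H).choose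

/-- A fixed orthonormal (Hilbert) basis of `L²(ℝ)`. -/
def basis : HilbertBasis basisIndex ℂ H := (exists_hilbertBasis ℂ H).choose_spec.choose

/-- The trace `Tr T = ∑ᵢ ⟨eᵢ, T eᵢ⟩` of a trace class operator (it does not depend on the basis). -/
def trace (T : TraceClass) : ℂ := ∑' i, inner ℂ (basis i) ((T : H →L[ℂ] H) (basis i))

/-- The squared Hilbert-Schmidt norm `‖T‖₂² = Tr(T† T) = ∑ᵢ ‖T eᵢ‖²` of a trace class operator. -/
def hsNormSq (T : TraceClass) : ℝ := ∑' i, ‖(T : H →L[ℂ] H) (basis i)‖ ^ 2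

/-- A (normal) state: a positive trace class operator of trace one. -/
def IsState (ρ : TraceClass) : Prop := (ρ : H →L[ℂ] H).IsPositive ∧ trace ρ = 1

/-- The rank-one operator `|φ⟩⟨φ|`. -/
def ketbra (φ : H) : TraceClass :=
  ⟨rankOne ℂ φ φ, isTraceClass_of_hasSum (fun _ : Unit => φ) (fun _ => φ)
    (Summable.of_finite) (by simp)⟩

/-! ### Operations -/

/-- Complete positivity: every ampliation `Λ ⊗ id` to `n × n` matrices of trace class operators
maps positive operators on `H ⊕ ⋯ ⊕ H` to positive operators. -/
def IsCompletelyPositive (Λ : TraceClass →ₗ[ℂ] TraceClass) : Prop :=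
  ∀ (n : ℕ) (T : Fin n → Fin n → TraceClass),
    (∀ v : Fin n → H, 0 ≤ ∑ i, ∑ j, inner ℂ (v i) ((T i j : H →L[ℂ] H) (v j))) →
    ∀ v : Fin n → H, 0 ≤ ∑ i, ∑ j, inner ℂ (v i) ((Λ (T i j) : H →L[ℂ] H) (v j))

/-- Trace preservation. -/
def IsTracePreserving (Λ : TraceClass →ₗ[ℂ] TraceClass) : Prop :=
  ∀ T, trace (Λ T) = trace T

/-- The operation `T ↦ K T K†` with the single Kraus operator `K`. -/
def krausMap (K : H →L[ℂ] H) : TraceClass →ₗ[ℂ] TraceClass where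
  toFun T := ⟨K ∘L (T : H →L[ℂ] H) ∘L K.adjoint, by
    obtain ⟨x, y, h, hT⟩ := T.2
    refine ⟨fun n => K (x n), fun n => K (y n), ?_, ?_⟩
    · refine Summable.of_nonneg_of_le (fun n => by positivity) (fun n => ?_)
        (h.mul_left (‖K‖ * ‖K‖))
      calc ‖K (x n)‖ * ‖K (y n)‖ ≤ (‖K‖ * ‖x n‖) * (‖K‖ * ‖y n‖) := by
            gcongr <;> exact K.le_opNorm _
        _ = ‖K‖ * ‖K‖ * (‖x n‖ * ‖y n‖) := by ring
    · have h1 := hT.mapL ((ContinuousLinearMap.compL ℂ H H H).flip K.adjoint)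
      have h2 := h1.mapL (ContinuousLinearMap.compL ℂ H H H K)
      convert h2 using 2 with n
      · ext1 v
        simp [ContinuousLinearMap.adjoint_inner_right]
      · rfl⟩
  map_add' S T := by ext1; simp [ContinuousLinearMap.add_comp, ContinuousLinearMap.comp_add]
  map_smul' c T := by ext1; simp [ContinuousLinearMap.smul_comp]

/-! ### Multiplication, projection and translation operators -/

/-- Multiplication by an essentially bounded function. -/
def mulOp (f : ℝ → ℂ) (hf : MemLp f ∞ volume) : H →L[ℂ] H :=
  (ContinuousLinearMap.mul ℂ ℂ).holderL volume ∞ 2 2 (hf.toLp f)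

theorem mulOp_coe (f : ℝ → ℂ) (hf : MemLp f ∞ volume) (φ : H) :
    mulOp f hf φ =ᵐ[volume] fun x => f x * φ x := by
  have h := (ContinuousLinearMap.mul ℂ ℂ).coeFn_holder (r := 2) (hf.toLp f) φ
  refine Filter.EventuallyEq.trans (by exact h) ?_
  filter_upwards [hf.coeFn_toLp] with x hx
  simp [hx]

/-- The projection `P_S` onto wave functions supported in the measurable set `S`. -/
def projOp (S : Set ℝ) (hS : MeasurableSet S) : H →L[ℂ] H :=
  mulOp (S.indicator fun _ => 1) (memLp_top_const (1 : ℂ) |>.indicator hS)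

/-- The translation `V_a`, `(V_a φ)(x) = φ(x - a)`. -/
def transOp (a : ℝ) : H →L[ℂ] H :=
  (Lp.compMeasurePreservingₗᵢ ℂ (fun x : ℝ => x - a)
    (measurePreserving_sub_right volume a)).toContinuousLinearMap

/-- The function `x ↦ e^{i p x / ħ}`. -/
def kickFun (ħ p : ℝ) (x : ℝ) : ℂ := Complex.exp ((p * x / ħ : ℝ) * Complex.I)

theorem norm_kickFun (ħ p x : ℝ) : ‖kickFun ħ p x‖ = 1 := Complex.norm_exp_ofReal_mul_I _

theorem memLp_kickFun (ħ p : ℝ) : MemLp (kickFun ħ p) ∞ volume :=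
  memLp_top_of_bound (by unfold kickFun; fun_prop) 1
    (Filter.Eventually.of_forall fun x => (norm_kickFun ħ p x).le)

/-- The momentum kick `e^{i p X / ħ}`, multiplication by `x ↦ e^{i p x / ħ}`. -/
def kick (ħ p : ℝ) : H →L[ℂ] H := mulOp (kickFun ħ p) (memLp_kickFun ħ p)

theorem kick_coe (ħ p : ℝ) (φ : H) :
    kick ħ p φ =ᵐ[volume] fun x => kickFun ħ p x * φ x := mulOp_coe _ _ _

theorem norm_kick (ħ p : ℝ) (φ : H) : ‖kick ħ p φ‖ = ‖φ‖ := by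
  rw [Lp.norm_def, Lp.norm_def]
  congr 1
  refine eLpNorm_congr_norm_ae ?_
  filter_upwards [kick_coe ħ p φ] with x hx
  rw [hx, norm_mul, norm_kickFun, one_mul]

theorem adjoint_kick (ħ p : ℝ) : (kick ħ p).adjoint = kick ħ (-p) := by
  symm
  rw [ContinuousLinearMap.eq_adjoint_iff]
  intro v w
  rw [L2.inner_def, L2.inner_def]
  refine integral_congr_ae ?_
  filter_upwards [kick_coe ħ (-p) v, kick_coe ħ p w] with x h1 h2
  have : (starRingEnd ℂ) (kickFun ħ (-p) x) = kickFun ħ p x := by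
    simp only [kickFun, ← Complex.exp_conj, map_mul, Complex.conj_ofReal, Complex.conj_I]
    congr 1
    push_cast
    ring
  rw [h1, h2]
  simp only [RCLike.inner_apply, map_mul, this]
  ring

theorem continuous_kick (ħ : ℝ) (φ : H) : Continuous fun p => kick ħ p φ := by
  have hin : ∀ q, Continuous fun p => inner ℂ (kick ħ q φ) (kick ħ p φ) := by
    intro q
    have h1 : ∀ p, inner ℂ (kick ħ q φ) (kick ħ p φ) =
        ∫ x, kickFun ħ p x * φ x * (starRingEnd ℂ) (kickFun ħ q x * φ x) := by
      intro p
      rw [L2.inner_def]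
      refine integral_congr_ae ?_
      filter_upwards [kick_coe ħ q φ, kick_coe ħ p φ] with x h1 h2
      rw [h1, h2, RCLike.inner_apply]
    simp_rw [h1]
    refine continuous_of_dominated (bound := fun x => ‖φ x‖ ^ 2) ?_ ?_ ?_ ?_
    · intro p
      have := (Lp.memLp φ).aestronglyMeasurable
      refine AEStronglyMeasurable.mul ((memLp_kickFun ħ p).aestronglyMeasurable.mul this) ?_
      exact Complex.continuous_conj.comp_aestronglyMeasurable
        ((memLp_kickFun ħ q).aestronglyMeasurable.mul this)
    · intro p
      refine Filter.Eventually.of_forall fun x => le_of_eq ?_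
      rw [norm_mul, RCLike.norm_conj, norm_mul, norm_mul, norm_kickFun, norm_kickFun]
      ring
    · exact (Lp.memLp φ).integrable_norm_pow (by norm_num)
    · refine Filter.Eventually.of_forall fun x => ?_
      unfold kickFun
      fun_prop
  refine continuous_iff_continuousAt.mpr fun q => ?_
  have h2 : ∀ p, ‖kick ħ p φ - kick ħ q φ‖ ^ 2 =
      2 * ‖φ‖ ^ 2 - 2 * (inner ℂ (kick ħ q φ) (kick ħ p φ)).re := by
    intro p
    rw [@norm_sub_rev, @norm_sub_sq ℂ, norm_kick, norm_kick]
    simp only [RCLike.re_to_complex]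
    ring
  have h3 : Filter.Tendsto (fun p => ‖kick ħ p φ - kick ħ q φ‖ ^ 2) (nhds q) (nhds 0) := by
    have hc : Continuous fun p => ‖kick ħ p φ - kick ħ q φ‖ ^ 2 := by
      simp_rw [h2]
      exact continuous_const.sub (continuous_const.mul (Complex.continuous_re.comp (hin q)))
    simpa using hc.tendsto q
  rw [ContinuousAt, tendsto_iff_norm_sub_tendsto_zero]
  have h4 := h3.sqrt
  simpa [Real.sqrt_sq] using h4

/-! ### The dephasing channel -/

theorem continuous_kick_conj (ħ : ℝ) (T : H →L[ℂ] H) (v : H) :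
    Continuous fun p => kick ħ p (T ((kick ħ p).adjoint v)) := by
  have hw : Continuous fun p => T ((kick ħ p).adjoint v) := by
    simp_rw [adjoint_kick]
    exact T.continuous.comp ((continuous_kick ħ v).comp continuous_neg)
  refine continuous_iff_continuousAt.mpr fun q => ?_
  rw [ContinuousAt, tendsto_iff_norm_sub_tendsto_zero]
  have h1 : Filter.Tendsto (fun p => ‖T ((kick ħ p).adjoint v) - T ((kick ħ q).adjoint v)‖ +
      ‖kick ħ p (T ((kick ħ q).adjoint v)) - kick ħ q (T ((kick ħ q).adjoint v))‖)
      (nhds q) (nhds 0) := by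
    have a := tendsto_iff_norm_sub_tendsto_zero.mp (hw.tendsto q)
    have b := tendsto_iff_norm_sub_tendsto_zero.mp
      ((continuous_kick ħ (T ((kick ħ q).adjoint v))).tendsto q)
    simpa using a.add b
  refine squeeze_zero (fun _ => norm_nonneg _) (fun p => ?_) h1
  rw [← norm_kick ħ p (T ((kick ħ p).adjoint v) - T ((kick ħ q).adjoint v)), map_sub]
  exact norm_sub_le_norm_sub_add_norm_sub _ _ _

theorem norm_kick_conj_le (ħ : ℝ) (T : H →L[ℂ] H) (v : H) (p : ℝ) :
    ‖kick ħ p (T ((kick ħ p).adjoint v))‖ ≤ ‖T‖ * ‖v‖ := by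
  rw [norm_kick, ← norm_kick ħ (-p) v, adjoint_kick]
  exact T.le_opNorm _

theorem integrable_kick_conj (ħ : ℝ) (μ : Measure ℝ) [IsProbabilityMeasure μ]
    (T : H →L[ℂ] H) (v : H) : Integrable (fun p => kick ħ p (T ((kick ħ p).adjoint v))) μ :=
  Integrable.of_bound (continuous_kick_conj ħ T v).aestronglyMeasurable (‖T‖ * ‖v‖)
    (Filter.Eventually.of_forall (norm_kick_conj_le ħ T v))

/-- The random momentum kick map on bounded operators,
`T ↦ ∫ e^{i p X / ħ} T e^{-i p X / ħ} dμ(p)`, the integral being taken in the strong sense. -/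
def dephaseBounded (ħ : ℝ) (μ : Measure ℝ) [IsProbabilityMeasure μ] :
    (H →L[ℂ] H) →L[ℂ] (H →L[ℂ] H) :=
  LinearMap.mkContinuous₂
    { toFun T :=
        { toFun v := ∫ p, kick ħ p (T ((kick ħ p).adjoint v)) ∂μ
          map_add' v w := by
            simp only [map_add]
            exact integral_add (integrable_kick_conj ħ μ T v) (integrable_kick_conj ħ μ T w)
          map_smul' c v := by
            simp only [map_smul, RingHom.id_apply]
            exact integral_smul c _ }
      map_add' S T := by
        ext1 v
        simp only [add_apply, map_add, LinearMap.coe_mk, AddHom.coe_mk,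
          LinearMap.add_apply]
        exact integral_add (integrable_kick_conj ħ μ S v) (integrable_kick_conj ħ μ T v)
      map_smul' c T := by
        ext1 v
        simp only [smul_apply, map_smul, LinearMap.coe_mk, AddHom.coe_mk,
          LinearMap.smul_apply, RingHom.id_apply]
        exact integral_smul c _ } 1 (by
    intro T v
    simp only [LinearMap.coe_mk, AddHom.coe_mk, one_mul]
    simpa using norm_integral_le_of_norm_le_const
      (Filter.Eventually.of_forall (f := ae μ) (norm_kick_conj_le ħ T v)))

theorem dephaseBounded_apply (ħ : ℝ) (μ : Measure ℝ) [IsProbabilityMeasure μ]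
    (T : H →L[ℂ] H) (v : H) :
    dephaseBounded ħ μ T v = ∫ p, kick ħ p (T ((kick ħ p).adjoint v)) ∂μ := rfl

/-- The component of `p ↦ e^{i p X / ħ} x` along `f ∈ L²(μ)`. -/
def kickCoeff (ħ : ℝ) (μ : Measure ℝ) (f : Lp ℂ 2 μ) (x : H) : H :=
  ∫ p, (starRingEnd ℂ) (f p) • kick ħ p x ∂μ

theorem memLp_inner_kick (ħ : ℝ) (μ : Measure ℝ) [IsProbabilityMeasure μ] (w x : H) :
    MemLp (fun p => inner ℂ w (kick ħ p x)) 2 μ := by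
  refine MemLp.of_bound
    (continuous_const.inner (continuous_kick ħ x)).aestronglyMeasurable (‖w‖ * ‖x‖)
    (Filter.Eventually.of_forall fun p => ?_)
  rw [← norm_kick ħ p x]
  exact norm_inner_le_norm _ _

theorem inner_kickCoeff (ħ : ℝ) (μ : Measure ℝ) [IsProbabilityMeasure μ] (f : Lp ℂ 2 μ)
    (w x : H) :
    inner ℂ w (kickCoeff ħ μ f x) = inner ℂ f (memLp_inner_kick ħ μ w x).toLp := by
  have hf : Integrable (fun p => (starRingEnd ℂ) (f p)) μ := by
    have : Integrable f μ := (Lp.memLp f).integrable (by norm_num)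
    exact (RCLike.conjLIE (K := ℂ)).toContinuousLinearEquiv.toContinuousLinearMap.integrable_comp
      this
  have hint : Integrable (fun p => (starRingEnd ℂ) (f p) • kick ħ p x) μ :=
    hf.smul_bdd ‖x‖ (continuous_kick ħ x).aestronglyMeasurable
      (Filter.Eventually.of_forall fun p => (norm_kick ħ p x).le)
  rw [kickCoeff, ← integral_inner hint, L2.inner_def]
  refine integral_congr_ae ?_
  filter_upwards [(memLp_inner_kick ħ μ w x).coeFn_toLp] with p hp
  rw [hp, inner_smul_right, RCLike.inner_apply, mul_comm]

theorem sum_norm_kickCoeff_sq_le (ħ : ℝ) (μ : Measure ℝ) [IsProbabilityMeasure μ]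
    {ι : Type*} (f : ι → Lp ℂ 2 μ) (hf : Orthonormal ℂ f) (x : H) (s : Finset ι) :
    ∑ i ∈ s, ‖kickCoeff ħ μ (f i) x‖ ^ 2 ≤ ‖x‖ ^ 2 := by
  have hpar : ∀ v : H, HasSum (fun k => ‖inner ℂ (basis k) v‖ ^ 2) (‖v‖ ^ 2) := by
    intro v
    have h := (basis.hasSum_inner_mul_inner v v).mapL Complex.reCLM
    convert h using 1
    · ext k
      rw [← inner_conj_symm v, Complex.reCLM_apply, Complex.conj_mul']
      norm_cast
    · rw [Complex.reCLM_apply, inner_self_eq_norm_sq_to_K]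
      norm_cast
  have h1 := hasSum_sum fun i (_ : i ∈ s) => hpar (kickCoeff ħ μ (f i) x)
  refine le_of_tendsto h1 (Filter.Eventually.of_forall fun t => ?_)
  calc ∑ k ∈ t, ∑ i ∈ s, ‖inner ℂ (basis k) (kickCoeff ħ μ (f i) x)‖ ^ 2
      ≤ ∑ k ∈ t, ‖(memLp_inner_kick ħ μ (basis k) x).toLp‖ ^ 2 := by
        refine Finset.sum_le_sum fun k _ => ?_
        simp_rw [inner_kickCoeff]
        exact hf.sum_inner_products_le _
    _ = ∑ k ∈ t, ∫ p, ‖inner ℂ (basis k : H) (kick ħ p x)‖ ^ 2 ∂μ := by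
        refine Finset.sum_congr rfl fun k _ => ?_
        have := @inner_self_eq_norm_sq ℂ _ _ _ _ (memLp_inner_kick ħ μ (basis k) x).toLp
        rw [← this, L2.inner_def, ← integral_re (L2.integrable_inner _ _)]
        refine integral_congr_ae ?_
        filter_upwards [(memLp_inner_kick ħ μ (basis k) x).coeFn_toLp] with p hp
        rw [hp, inner_self_eq_norm_sq]
    _ = ∫ p, ∑ k ∈ t, ‖inner ℂ (basis k : H) (kick ħ p x)‖ ^ 2 ∂μ := by
        rw [integral_finsetSum]
        intro k _
        exact (memLp_inner_kick ħ μ (basis k) x).integrable_norm_pow (by norm_num)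
    _ ≤ ∫ _, ‖x‖ ^ 2 ∂μ := by
        refine integral_mono ?_ (integrable_const _) fun p => ?_
        · refine integrable_finsetSum _ fun k _ => ?_
          exact (memLp_inner_kick ħ μ (basis k) x).integrable_norm_pow (by norm_num)
        · simp only
          rw [← norm_kick ħ p x]
          exact basis.orthonormal.sum_inner_products_le _
    _ = ‖x‖ ^ 2 := by simp

/-- The random momentum kick map sends trace class operators to trace class operators. -/
theorem isTraceClass_dephaseBounded (ħ : ℝ) (μ : Measure ℝ) [IsProbabilityMeasure μ]
    (T : H →L[ℂ] H) (hT : IsTraceClass T) : IsTraceClass (dephaseBounded ħ μ T) := by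
  obtain ⟨x, y, hs, hT⟩ := hT
  obtain ⟨w, f, -⟩ := exists_hilbertBasis ℂ (Lp ℂ 2 μ)
  have hcs : ∀ u z : H,
      Summable (fun i => ‖kickCoeff ħ μ (f i) u‖ * ‖kickCoeff ħ μ (f i) z‖) ∧
      ∑' i, ‖kickCoeff ħ μ (f i) u‖ * ‖kickCoeff ħ μ (f i) z‖ ≤ ‖u‖ * ‖z‖ := by
    intro u z
    have key : ∀ s : Finset w, ∑ i ∈ s, ‖kickCoeff ħ μ (f i) u‖ * ‖kickCoeff ħ μ (f i) z‖ ≤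
        ‖u‖ * ‖z‖ := by
      intro s
      refine (Real.sum_mul_le_sqrt_mul_sqrt s _ _).trans ?_
      gcongr
      · exact Real.sqrt_le_iff.mpr ⟨norm_nonneg _,
          sum_norm_kickCoeff_sq_le ħ μ f f.orthonormal u s⟩
      · exact Real.sqrt_le_iff.mpr ⟨norm_nonneg _,
          sum_norm_kickCoeff_sq_le ħ μ f f.orthonormal z s⟩
    exact ⟨summable_of_sum_le (fun _ => by positivity) key,
      Real.tsum_le_of_sum_le (fun _ => by positivity) key⟩
  have hone : ∀ u z : H, HasSum
      (fun i => rankOne ℂ (kickCoeff ħ μ (f i) u) (kickCoeff ħ μ (f i) z))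
      (dephaseBounded ħ μ (rankOne ℂ u z)) := by
    intro u z
    have hsum : Summable
        (fun i => rankOne ℂ (kickCoeff ħ μ (f i) u) (kickCoeff ħ μ (f i) z)) :=
      Summable.of_norm (by simpa using (hcs u z).1)
    convert hsum.hasSum
    ext1 v
    refine ext_inner_left ℂ fun t => ?_
    have h1 := (hsum.hasSum.mapL (ContinuousLinearMap.apply ℂ H v)).mapL (innerSL ℂ t)
    have h2 := f.hasSum_inner_mul_inner (memLp_inner_kick ħ μ v z).toLp
      (memLp_inner_kick ħ μ t u).toLp
    have h3 : inner ℂ (memLp_inner_kick ħ μ v z).toLp (memLp_inner_kick ħ μ t u).toLp =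
        inner ℂ t (dephaseBounded ħ μ (rankOne ℂ u z) v) := by
      rw [dephaseBounded_apply, ← integral_inner (integrable_kick_conj ħ μ _ v), L2.inner_def]
      refine integral_congr_ae ?_
      filter_upwards [(memLp_inner_kick ħ μ v z).coeFn_toLp,
        (memLp_inner_kick ħ μ t u).coeFn_toLp] with p h1 h2
      rw [h1, h2, rankOne_apply, map_smul, inner_smul_right,
        ContinuousLinearMap.adjoint_inner_right, RCLike.inner_apply, inner_conj_symm, mul_comm]
    rw [h3] at h2
    refine h2.unique ?_
    convert h1 using 1
    · ext i
      rw [← inner_kickCoeff, ← inner_conj_symm, ← inner_kickCoeff, inner_conj_symm]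
      simp
    · rfl
  have hprod : Summable (fun q : ℕ × w =>
      ‖kickCoeff ħ μ (f q.2) (x q.1)‖ * ‖kickCoeff ħ μ (f q.2) (y q.1)‖) := by
    rw [summable_prod_of_nonneg (fun _ => by positivity)]
    exact ⟨fun n => (hcs (x n) (y n)).1, hs.of_nonneg_of_le
      (fun n => tsum_nonneg fun _ => by positivity) (fun n => (hcs (x n) (y n)).2)⟩
  have hsum : Summable (fun q : ℕ × w =>
      rankOne ℂ (kickCoeff ħ μ (f q.2) (x q.1)) (kickCoeff ħ μ (f q.2) (y q.1))) :=
    Summable.of_norm (by simpa using hprod)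
  refine isTraceClass_of_hasSum _ _ hprod ?_
  convert hsum.hasSum
  exact (hT.mapL (dephaseBounded ħ μ)).unique
    (hsum.hasSum.prod_fiberwise fun n => hone (x n) (y n))

/-- The dephasing channel `Δ_g` with momentum kicks distributed according to the probability
measure `μ`: `Δ_g(T) = ∫ e^{i p X / ħ} T e^{-i p X / ħ} dμ(p)`. In the position representation it
multiplies the kernel `T(x, y)` by `g(x - y)`, where `g(ξ) = ∫ e^{i p ξ / ħ} dμ(p)`. -/
def dephase (ħ : ℝ) (μ : Measure ℝ) [IsProbabilityMeasure μ] : TraceClass →ₗ[ℂ] TraceClass :=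
  (dephaseBounded ħ μ).toLinearMap.restrict (isTraceClass_dephaseBounded ħ μ)

/-- The `l₂` `g`-dephasing loss `C₂^g(ρ) = ‖ρ‖₂² - ‖Δ_g(ρ)‖₂²`. -/
def l2Loss (ħ : ℝ) (μ : Measure ℝ) [IsProbabilityMeasure μ] (ρ : TraceClass) : ℝ :=
  hsNormSq ρ - hsNormSq (dephase ħ μ ρ)

/-! ### Dephasing-covariant operations and strong monotonicity -/

/-- `Λ ∘ Δ_g = Δ_g ∘ Λ`. -/
def IsDephasingCovariant (ħ : ℝ) (μ : Measure ℝ) [IsProbabilityMeasure μ]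
    (Λ : TraceClass →ₗ[ℂ] TraceClass) : Prop :=
  Λ ∘ₗ dephase ħ μ = dephase ħ μ ∘ₗ Λ

/-- The class `DIO_g` of completely positive, trace preserving maps that commute with `Δ_g`. -/
def IsDIO (ħ : ℝ) (μ : Measure ℝ) [IsProbabilityMeasure μ]
    (Λ : TraceClass →ₗ[ℂ] TraceClass) : Prop :=
  IsCompletelyPositive Λ ∧ IsTracePreserving Λ ∧ IsDephasingCovariant ħ μ Λ

/-- A finite quantum instrument under `DIO_g`: the branches are completely positive and
dephasing-covariant, and their sum is trace preserving (so that the sum belongs to `DIO_g`). -/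
structure IsDIOInstrument (ħ : ℝ) (μ : Measure ℝ) [IsProbabilityMeasure μ] {n : ℕ}
    (Λ : Fin n → (TraceClass →ₗ[ℂ] TraceClass)) : Prop where
  completelyPositive : ∀ k, IsCompletelyPositive (Λ k)
  covariant : ∀ k, IsDephasingCovariant ħ μ (Λ k)
  sum_isDIO : IsDIO ħ μ (∑ k, Λ k)

/-- The probability `p = Tr Λ(ρ)` of the branch `Λ`. -/
def branchProb (Λ : TraceClass →ₗ[ℂ] TraceClass) (ρ : TraceClass) : ℝ := (trace (Λ ρ)).re

/-- The post-measurement state `Λ(ρ) / p` of the branch `Λ` (meaningful if `p ≠ 0`). -/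
def branchState (Λ : TraceClass →ₗ[ℂ] TraceClass) (ρ : TraceClass) : TraceClass :=
  ((branchProb Λ ρ : ℂ)⁻¹) • Λ ρ

/-- The average `∑ₖ pₖ C(ρₖ)` over the branches of an instrument (branches with `pₖ = 0` do not
contribute). -/
def averageAfter {n : ℕ} (C : TraceClass → ℝ) (Λ : Fin n → (TraceClass →ₗ[ℂ] TraceClass))
    (ρ : TraceClass) : ℝ :=
  ∑ k, branchProb (Λ k) ρ * C (branchState (Λ k) ρ)

/-- Strong monotonicity of `C` under `DIO_g`: `C(ρ) ≥ ∑ₖ pₖ C(ρₖ)` for all states and all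
instruments with dephasing-covariant branches. -/
def IsStronglyMonotone (ħ : ℝ) (μ : Measure ℝ) [IsProbabilityMeasure μ]
    (C : TraceClass → ℝ) : Prop :=
  ∀ (n : ℕ) (Λ : Fin n → (TraceClass →ₗ[ℂ] TraceClass)), IsDIOInstrument ħ μ Λ →
    ∀ ρ, IsState ρ → averageAfter C Λ ρ ≤ C ρ

/-! ### The two-packet mixture and its three-outcome instrument -/

/-- The translated set `C + a`. -/
def shift (C : Set ℝ) (a : ℝ) : Set ℝ := {x | x - a ∈ C}

theorem measurableSet_shift {C : Set ℝ} (hC : MeasurableSet C) (a : ℝ) :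
    MeasurableSet (shift C a) := (measurable_id.sub_const a) hC

/-- Admissible data: a normalized `φ` vanishing a.e. outside a bounded measurable set `C`, and
displacements `a`, `b` for which `C + a` and `C + b` are disjoint. -/
structure IsPacketPair (φ : H) (C : Set ℝ) (a b : ℝ) : Prop where
  norm_eq_one : ‖φ‖ = 1
  measurable : MeasurableSet C
  bounded : Bornology.IsBounded C
  vanish : ∀ᵐ x, x ∉ C → φ x = 0
  disjoint : Disjoint (shift C a) (shift C b)

/-- The Kraus operators `K_A = V_{-a} P_A`, `K_B = V_{-b} P_B`, `K_0 = P_{(A ∪ B)ᶜ}`, where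
`A = C + a` and `B = C + b`. -/
def packetKraus (C : Set ℝ) (hC : MeasurableSet C) (a b : ℝ) : Fin 3 → (H →L[ℂ] H) :=
  ![transOp (-a) ∘L projOp (shift C a) (measurableSet_shift hC a),
    transOp (-b) ∘L projOp (shift C b) (measurableSet_shift hC b),
    projOp (shift C a ∪ shift C b)ᶜ
      ((measurableSet_shift hC a).union (measurableSet_shift hC b)).compl]

/-- The instrument `T ↦ K_j T K_j†`, `j ∈ {A, B, 0}`. -/
def packetInstrument (C : Set ℝ) (hC : MeasurableSet C) (a b : ℝ) :
    Fin 3 → (TraceClass →ₗ[ℂ] TraceClass) :=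
  fun j => krausMap (packetKraus C hC a b j)

/-- The mixture `½ |φ_a⟩⟨φ_a| + ½ |φ_b⟩⟨φ_b|` of two translates `φ_x = V_x φ` of `φ`. -/
def packetMixture (φ : H) (a b : ℝ) : TraceClass :=
  (1 / 2 : ℂ) • ketbra (transOp a φ) + (1 / 2 : ℂ) • ketbra (transOp b φ)

end PositionCoherence

end

open PositionCoherence

noncomputable section

namespace PositionCoherence

/-! ### Traces and Hilbert-Schmidt norms of nuclear sums -/

/-! The loss is homogeneous of degree two, whereas strong monotonicity compares it with an average
that is linear in the branch weights. Mixing two orthogonally localized copies of a state with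
weights ½ therefore costs a factor `2 * (1/2)^2 = 1/2`, and a covariant measurement that finds out
which copy is present removes this factor.

Two facts make the sorting free. Momentum kicks are multiplication operators, so they commute with
position projections; and they commute with translations up to a unimodular phase, which cancels
under conjugation (`isDephasingCovariant_krausMap`). Hence `Δ_g` keeps operators localized in `A` or
`B` where they are, so the Hilbert-Schmidt norms of the packets add both before and after dephasing
(`l2Loss_add_of_disjoint`), and both packets have the loss of `φ` (`l2Loss_krausMap_transOp`). The
outcomes A and B each return `φ` with probability ½, and the third outcome has probability zero.

Strictness comes from the purity formula `hsNormSq_dephase_ketbra`: the dephased pure state has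
squared norm `∬ |⟨φ_p, φ_q⟩|² dμ dμ`, where in this formula `φ_p` is the kicked vector. Distinct
kicks of a nonzero wave function are never parallel (`norm_inner_kick_lt`), and a measure that is
not a Dirac mass charges the complement of every point, so the integral is below one. -/

theorem krausMap_apply (K : H →L[ℂ] H) (T : TraceClass) (v : H) :
    (krausMap K T : H →L[ℂ] H) v = K ((T : H →L[ℂ] H) (K.adjoint v)) := rfl

theorem dephase_coe (ħ : ℝ) (μ : Measure ℝ) [IsProbabilityMeasure μ] (T : TraceClass) :
    (dephase ħ μ T : H →L[ℂ] H) = dephaseBounded ħ μ T := rfl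

theorem hasSum_norm_inner_basis_sq (v : H) :
    HasSum (fun i => ‖inner ℂ (basis i) v‖ ^ 2) (‖v‖ ^ 2) := by
  have h := (basis.hasSum_inner_mul_inner v v).mapL Complex.reCLM
  convert h using 1
  · ext k
    rw [← inner_conj_symm v, Complex.reCLM_apply, Complex.conj_mul']
    norm_cast
  · rw [Complex.reCLM_apply, inner_self_eq_norm_sq_to_K]
    norm_cast

/-- Cauchy-Schwarz and Bessel on finite subsets. The explicit bound is what allows a further
summation over the terms of a nuclear decomposition. -/
theorem summable_norm_inner_mul_norm_inner (u v : H) :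
    Summable (fun i => ‖inner ℂ u (basis i)‖ * ‖inner ℂ (basis i) v‖) ∧
      ∑' i, ‖inner ℂ u (basis i)‖ * ‖inner ℂ (basis i) v‖ ≤ ‖u‖ * ‖v‖ := by
  have key : ∀ s : Finset basisIndex,
      ∑ i ∈ s, ‖inner ℂ u (basis i)‖ * ‖inner ℂ (basis i) v‖ ≤ ‖u‖ * ‖v‖ := by
    intro s
    refine (Real.sum_mul_le_sqrt_mul_sqrt s _ _).trans ?_
    gcongr
    · refine Real.sqrt_le_iff.mpr ⟨norm_nonneg _, ?_⟩
      simp_rw [norm_inner_symm u]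
      exact basis.orthonormal.sum_inner_products_le _
    · exact Real.sqrt_le_iff.mpr ⟨norm_nonneg _, basis.orthonormal.sum_inner_products_le _⟩
  exact ⟨summable_of_sum_le (fun _ => by positivity) key,
    Real.tsum_le_of_sum_le (fun _ => by positivity) key⟩

/-- The trace of a nuclear sum, with the diagonal matrix entries summing to it. -/
theorem hasSum_inner_basis_of_hasSum {T : H →L[ℂ] H} (x y : ℕ → H)
    (hs : Summable fun n => ‖x n‖ * ‖y n‖) (hT : HasSum (fun n => rankOne ℂ (x n) (y n)) T) :
    HasSum (fun i => inner ℂ (basis i) (T (basis i))) (∑' n, inner ℂ (y n) (x n)) := by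
  -- This double family is absolutely summable, so it may be summed in either order: along the basis
  -- first, Parseval gives `⟨y n, x n⟩`; along `n` first, the diagonal entries of `T` appear.
  set F : ℕ × basisIndex → ℂ :=
    fun q => inner ℂ (y q.1) (basis q.2) * inner ℂ (basis q.2) (x q.1)
  have hF : Summable F := by
    refine Summable.of_norm ?_
    simp only [F, norm_mul]
    rw [summable_prod_of_nonneg (fun _ => by positivity)]
    refine ⟨fun n => (summable_norm_inner_mul_norm_inner (y n) (x n)).1,
      hs.of_nonneg_of_le (fun n => tsum_nonneg fun _ => by positivity) fun n => ?_⟩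
    rw [mul_comm ‖x n‖]
    exact (summable_norm_inner_mul_norm_inner (y n) (x n)).2
  have h1 : HasSum F (∑' n, inner ℂ (y n) (x n)) := by
    have h := hF.hasSum.prod_fiberwise fun n => basis.hasSum_inner_mul_inner (y n) (x n)
    rw [h.tsum_eq]
    exact hF.hasSum
  have h2 : HasSum (F ∘ Prod.swap) (∑' n, inner ℂ (y n) (x n)) :=
    (Equiv.prodComm basisIndex ℕ).hasSum_iff.mpr h1
  refine h2.prod_fiberwise fun i => ?_
  have h3 := (hT.mapL (ContinuousLinearMap.apply ℂ H (basis i))).mapL (innerSL ℂ (basis i))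
  simpa only [F, Function.comp_apply, Prod.swap_prod_mk, ContinuousLinearMap.apply_apply,
    rankOne_apply, innerSL_apply_apply, inner_smul_right] using h3

theorem trace_eq_tsum {T : TraceClass} (x y : ℕ → H) (hs : Summable fun n => ‖x n‖ * ‖y n‖)
    (hT : HasSum (fun n => rankOne ℂ (x n) (y n)) (T : H →L[ℂ] H)) :
    trace T = ∑' n, inner ℂ (y n) (x n) :=
  (hasSum_inner_basis_of_hasSum x y hs hT).tsum_eq

theorem summable_inner_basis (T : TraceClass) :
    Summable fun i => inner ℂ (basis i) ((T : H →L[ℂ] H) (basis i)) := by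
  obtain ⟨x, y, hs, hT⟩ := T.2
  exact (hasSum_inner_basis_of_hasSum x y hs hT).summable

theorem trace_add (S T : TraceClass) : trace (S + T) = trace S + trace T := by
  simp only [trace, Submodule.coe_add, add_apply, inner_add_right]
  exact (summable_inner_basis S).tsum_add (summable_inner_basis T)

theorem trace_smul (c : ℂ) (T : TraceClass) : trace (c • T) = c * trace T := by
  simp only [trace, Submodule.coe_smul, smul_apply, inner_smul_right, tsum_mul_left]

theorem trace_zero : trace 0 = 0 := by simpa using trace_smul 0 0

theorem trace_ketbra (φ : H) : trace (ketbra φ) = (‖φ‖ : ℂ) ^ 2 := by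
  refine Eq.trans ?_ (inner_self_eq_norm_sq_to_K (𝕜 := ℂ) φ)
  rw [trace, ← (basis.hasSum_inner_mul_inner φ φ).tsum_eq]
  refine tsum_congr fun i => ?_
  simp [ketbra, inner_smul_right]

theorem ketbra_zero : ketbra 0 = 0 := by
  ext1
  simp [ketbra]

/-- The numbers `‖A eᵢ‖²` are the diagonal entries of `A†A`, which inherits the nuclear
decomposition `∑ |A† x n⟩⟨y n|`. -/
theorem summable_norm_basis_sq (T : TraceClass) :
    Summable fun i => ‖(T : H →L[ℂ] H) (basis i)‖ ^ 2 := by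
  obtain ⟨x, y, hs, hT⟩ := T.2
  set A : H →L[ℂ] H := (T : H →L[ℂ] H)
  have h1 : HasSum (fun n => rankOne ℂ (A.adjoint (x n)) (y n)) (A.adjoint ∘L A) := by
    convert hT.mapL (ContinuousLinearMap.compL ℂ H H H A.adjoint) using 2
    · ext1 v
      simp
    · rfl
  have h2 : Summable fun n => ‖A.adjoint (x n)‖ * ‖y n‖ := by
    refine (hs.mul_left ‖A.adjoint‖).of_nonneg_of_le (fun n => by positivity) fun n => ?_
    rw [← mul_assoc]
    gcongr
    exact A.adjoint.le_opNorm _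
  convert ((hasSum_inner_basis_of_hasSum _ _ h2 h1).mapL Complex.reCLM).summable using 2 with i
  simp only [ContinuousLinearMap.coe_comp, Function.comp_apply, Complex.reCLM_apply,
    ContinuousLinearMap.adjoint_inner_right]
  exact (inner_self_eq_norm_sq (𝕜 := ℂ) _).symm

/-- Both sides are double sums of `|⟨e_j, A e_i⟩|²`, exchanged by Tonelli in `ℝ≥0∞`. No
Hilbert-Schmidt assumption is needed: a divergent sum becomes 0 on both sides, as `toReal ∞` and as
a non-summable `tsum`. -/
theorem tsum_norm_basis_sq_adjoint (A : H →L[ℂ] H) :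
    ∑' i, ‖A.adjoint (basis i)‖ ^ 2 = ∑' i, ‖A (basis i)‖ ^ 2 := by
  have key : ∀ B : H →L[ℂ] H, ∑' i, ‖B (basis i)‖ ^ 2 =
      (∑' i, ∑' j, ENNReal.ofReal (‖inner ℂ (basis j) (B (basis i))‖ ^ 2)).toReal := by
    intro B
    have h : ∀ i, ∑' j, ENNReal.ofReal (‖inner ℂ (basis j) (B (basis i))‖ ^ 2) =
        ENNReal.ofReal (‖B (basis i)‖ ^ 2) := by
      intro i
      have := hasSum_norm_inner_basis_sq (B (basis i))
      rw [← this.tsum_eq, ENNReal.ofReal_tsum_of_nonneg (fun _ => by positivity) this.summable]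
    simp_rw [h]
    rw [ENNReal.tsum_toReal_eq fun _ => ENNReal.ofReal_ne_top]
    refine tsum_congr fun i => ?_
    rw [ENNReal.toReal_ofReal (by positivity)]
  rw [key, key A, ENNReal.tsum_comm]
  congr 1
  refine tsum_congr fun i => tsum_congr fun j => ?_
  rw [ContinuousLinearMap.adjoint_inner_right, norm_inner_symm]

theorem hsNormSq_smul (c : ℂ) (T : TraceClass) : hsNormSq (c • T) = ‖c‖ ^ 2 * hsNormSq T := by
  simp only [hsNormSq, Submodule.coe_smul, smul_apply, norm_smul, mul_pow, tsum_mul_left]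

theorem hsNormSq_ketbra (φ : H) : hsNormSq (ketbra φ) = (‖φ‖ ^ 2) ^ 2 := by
  rw [sq (‖φ‖ ^ 2)]
  nth_rw 1 [← (hasSum_norm_inner_basis_sq φ).tsum_eq]
  rw [← tsum_mul_right, hsNormSq]
  refine tsum_congr fun i => ?_
  simp [ketbra, norm_smul, mul_pow, norm_inner_symm]

/-- Conjugation with an isometry preserves the Hilbert-Schmidt norm. -/
theorem hsNormSq_krausMap_of_isometry {V : H →L[ℂ] H} (hV : ∀ v, ‖V v‖ = ‖v‖) (T : TraceClass) :
    hsNormSq (krausMap V T) = hsNormSq T := by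
  set A : H →L[ℂ] H := (T : H →L[ℂ] H)
  -- The left factor `V` drops out because it preserves norms. The right factor `V†` need not, so it
  -- is turned into a left factor `V` by passing to the adjoint.
  have h : ∀ v, ‖(A ∘L V.adjoint).adjoint v‖ = ‖A.adjoint v‖ := by
    intro v
    rw [ContinuousLinearMap.adjoint_comp, ContinuousLinearMap.adjoint_adjoint]
    exact hV _
  calc hsNormSq (krausMap V T) = ∑' i, ‖(A ∘L V.adjoint) (basis i)‖ ^ 2 :=
        tsum_congr fun i => by rw [krausMap_apply, hV]; rfl
    _ = ∑' i, ‖A.adjoint (basis i)‖ ^ 2 := by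
        rw [← tsum_norm_basis_sq_adjoint]
        exact tsum_congr fun i => by rw [h]
    _ = hsNormSq T := tsum_norm_basis_sq_adjoint A

/-- The squared Hilbert-Schmidt norm is additive on operators with orthogonal ranges. -/
theorem hsNormSq_add_of_orthogonal {S T : TraceClass}
    (h : ∀ v, inner ℂ ((S : H →L[ℂ] H) v) ((T : H →L[ℂ] H) v) = 0) :
    hsNormSq (S + T) = hsNormSq S + hsNormSq T := by
  rw [hsNormSq, hsNormSq, hsNormSq,
    ← (summable_norm_basis_sq S).tsum_add (summable_norm_basis_sq T)]
  refine tsum_congr fun i => ?_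
  simpa [sq] using norm_add_sq_eq_norm_sq_add_norm_sq_of_inner_eq_zero _ _ (h (basis i))

/-! ### Operations given by Kraus operators -/

theorem krausMap_ketbra (K : H →L[ℂ] H) (φ : H) : krausMap K (ketbra φ) = ketbra (K φ) := by
  ext1
  ext1 v
  simp [krausMap_apply, ketbra, ContinuousLinearMap.adjoint_inner_right]

/-- Positivity is tested on the vectors `K† vᵢ`. -/
theorem isCompletelyPositive_krausMap (K : H →L[ℂ] H) : IsCompletelyPositive (krausMap K) := by
  intro n T hT v
  simpa only [krausMap_apply, ContinuousLinearMap.adjoint_inner_left] using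
    hT fun i => K.adjoint (v i)

theorem isCompletelyPositive_sum {n : ℕ} {Λ : Fin n → (TraceClass →ₗ[ℂ] TraceClass)}
    (h : ∀ k, IsCompletelyPositive (Λ k)) : IsCompletelyPositive (∑ k, Λ k) := by
  intro m T hT v
  simp only [LinearMap.sum_apply, Submodule.coe_sum, sum_apply, inner_sum]
  rw [Finset.sum_comm_cycle]
  exact Finset.sum_nonneg fun k _ => h k m T hT v

theorem trace_sum {ι : Type*} (s : Finset ι) (T : ι → TraceClass) :
    trace (∑ k ∈ s, T k) = ∑ k ∈ s, trace (T k) := by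
  classical
  induction s using Finset.induction_on with
  | empty => simpa using trace_zero
  | insert k s hk ih => rw [Finset.sum_insert hk, Finset.sum_insert hk, trace_add, ih]

/-- Each branch has the nuclear decomposition `∑ |K x n⟩⟨K y n|`, so its trace is `∑ ⟨K y n, K x
n⟩`; summing over the branches inside the series produces `∑ K†K` between `y n` and `x n`. -/
theorem isTracePreserving_sum_krausMap {n : ℕ} {K : Fin n → (H →L[ℂ] H)}
    (hK : ∑ j, (K j).adjoint ∘L K j = ContinuousLinearMap.id ℂ H) :
    IsTracePreserving (∑ j, krausMap (K j)) := by
  intro T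
  obtain ⟨x, y, hs, hT⟩ := T.2
  have hKs : ∀ j, Summable fun n => ‖K j (x n)‖ * ‖K j (y n)‖ := by
    intro j
    refine (hs.mul_left (‖K j‖ * ‖K j‖)).of_nonneg_of_le (fun n => by positivity) fun n => ?_
    calc ‖K j (x n)‖ * ‖K j (y n)‖ ≤ (‖K j‖ * ‖x n‖) * (‖K j‖ * ‖y n‖) := by
          gcongr <;> exact (K j).le_opNorm _
      _ = ‖K j‖ * ‖K j‖ * (‖x n‖ * ‖y n‖) := by ring
  have hKT : ∀ j, HasSum (fun n => rankOne ℂ (K j (x n)) (K j (y n)))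
      (krausMap (K j) T : H →L[ℂ] H) := by
    intro j
    have h1 := hT.mapL ((ContinuousLinearMap.compL ℂ H H H).flip (K j).adjoint)
    convert h1.mapL (ContinuousLinearMap.compL ℂ H H H (K j)) using 2 with n
    · ext1 v
      simp [ContinuousLinearMap.adjoint_inner_right]
    · rfl
  rw [LinearMap.sum_apply, trace_sum, trace_eq_tsum x y hs hT]
  simp_rw [fun j => trace_eq_tsum _ _ (hKs j) (hKT j)]
  rw [← Summable.tsum_finsetSum fun j _ => Summable.of_norm_bounded (hKs j) fun n => by
    rw [mul_comm]; exact norm_inner_le_norm _ _]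
  refine tsum_congr fun n => ?_
  have h := congrArg (fun A : H →L[ℂ] H => inner ℂ (y n) (A (x n))) hK
  simpa [sum_apply, inner_sum, ContinuousLinearMap.adjoint_inner_right] using h

/-- An operator that commutes with all momentum kicks up to phases gives a dephasing-covariant
operation. -/
theorem isDephasingCovariant_krausMap (ħ : ℝ) (μ : Measure ℝ) [IsProbabilityMeasure μ]
    {K : H →L[ℂ] H} (hK : ∀ p, ∃ c : ℂ, ‖c‖ = 1 ∧ kick ħ p ∘L K = c • (K ∘L kick ħ p)) :
    IsDephasingCovariant ħ μ (krausMap K) := by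
  ext T : 2
  ext1 v
  simp only [LinearMap.comp_apply, krausMap_apply, dephase_coe, dephaseBounded_apply]
  rw [← ContinuousLinearMap.integral_comp_comm _ (integrable_kick_conj ħ μ _ _)]
  refine integral_congr_ae (Filter.Eventually.of_forall fun p => ?_)
  obtain ⟨c, hc, h⟩ := hK p
  have h1 : ∀ w, kick ħ p (K w) = c • K (kick ħ p w) := fun w => DFunLike.congr_fun h w
  have h2 : K.adjoint ((kick ħ p).adjoint v) =
      (starRingEnd ℂ) c • (kick ħ p).adjoint (K.adjoint v) := by
    have := congrArg (fun A : H →L[ℂ] H => A.adjoint v) h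
    simpa only [ContinuousLinearMap.adjoint_comp, map_smulₛₗ, smul_apply,
      ContinuousLinearMap.coe_comp, Function.comp_apply] using this
  -- The phase from the left and its conjugate from the right multiply to `‖c‖² = 1`.
  simp only [h1, h2, map_smul, smul_smul]
  rw [Complex.conj_mul', hc]
  simp

/-! ### Algebra of multiplication and translation operators -/

theorem mulOp_comm (f g : ℝ → ℂ) (hf : MemLp f ∞ volume) (hg : MemLp g ∞ volume) :
    mulOp f hf ∘L mulOp g hg = mulOp g hg ∘L mulOp f hf := by
  ext1 v
  refine Lp.ext ?_
  simp only [ContinuousLinearMap.coe_comp, Function.comp_apply]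
  filter_upwards [mulOp_coe f hf (mulOp g hg v), mulOp_coe g hg v, mulOp_coe g hg (mulOp f hf v),
    mulOp_coe f hf v] with x h1 h2 h3 h4
  rw [h1, h2, h3, h4]
  ring

theorem projOp_coe {S : Set ℝ} (hS : MeasurableSet S) (φ : H) :
    projOp S hS φ =ᵐ[volume] S.indicator φ := by
  filter_upwards [mulOp_coe _ (memLp_top_const (1 : ℂ) |>.indicator hS) φ] with x hx
  rw [projOp, hx]
  by_cases h : x ∈ S <;> simp [h]

theorem transOp_coe (a : ℝ) (φ : H) : transOp a φ =ᵐ[volume] fun x => φ (x - a) :=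
  Lp.coeFn_compMeasurePreserving φ (measurePreserving_sub_right volume a)

theorem norm_transOp (a : ℝ) (φ : H) : ‖transOp a φ‖ = ‖φ‖ :=
  LinearIsometry.norm_map _ φ

/-- Translations preserve null sets, so an almost everywhere identity may be evaluated at the
shifted point when operators are composed. -/
theorem ae_sub_right {P : ℝ → Prop} (h : ∀ᵐ x, P x) (a : ℝ) : ∀ᵐ x, P (x - a) :=
  (measurePreserving_sub_right volume a).quasiMeasurePreserving.ae h

theorem transOp_neg_transOp (a : ℝ) (φ : H) : transOp (-a) (transOp a φ) = φ := by
  refine Lp.ext ?_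
  filter_upwards [transOp_coe (-a) (transOp a φ), ae_sub_right (transOp_coe a φ) (-a)]
    with x h1 h2
  rw [h1, h2]
  simp

theorem kick_comp_projOp (ħ p : ℝ) {S : Set ℝ} (hS : MeasurableSet S) :
    kick ħ p ∘L projOp S hS = projOp S hS ∘L kick ħ p := mulOp_comm _ _ _ _

/-- The Weyl relation, from `e^{ipx/ħ} = e^{ipa/ħ} e^{ip(x-a)/ħ}`. -/
theorem kick_comp_transOp (ħ p a : ℝ) :
    kick ħ p ∘L transOp a = kickFun ħ p a • (transOp a ∘L kick ħ p) := by
  ext1 v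
  refine Lp.ext ?_
  simp only [ContinuousLinearMap.coe_comp, Function.comp_apply, smul_apply]
  filter_upwards [kick_coe ħ p (transOp a v), transOp_coe a v,
    Lp.coeFn_smul (kickFun ħ p a) (transOp a (kick ħ p v)), transOp_coe a (kick ħ p v),
    ae_sub_right (kick_coe ħ p v) a] with x h1 h2 h3 h4 h5
  rw [h1, h2, h3, Pi.smul_apply, h4, h5, smul_eq_mul, ← mul_assoc]
  congr 1
  rw [kickFun, kickFun, kickFun, ← Complex.exp_add]
  congr 1
  push_cast
  ring

theorem adjoint_projOp {S : Set ℝ} (hS : MeasurableSet S) :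
    (projOp S hS).adjoint = projOp S hS := by
  symm
  rw [ContinuousLinearMap.eq_adjoint_iff]
  intro v w
  rw [L2.inner_def, L2.inner_def]
  refine integral_congr_ae ?_
  filter_upwards [projOp_coe hS v, projOp_coe hS w] with x h1 h2
  rw [h1, h2]
  by_cases h : x ∈ S <;> simp [h]

theorem projOp_projOp {S T : Set ℝ} (hS : MeasurableSet S) (hT : MeasurableSet T) (φ : H) :
    projOp S hS (projOp T hT φ) = projOp (S ∩ T) (hS.inter hT) φ := by
  refine Lp.ext ?_
  filter_upwards [projOp_coe hS (projOp T hT φ), projOp_coe hT φ, projOp_coe (hS.inter hT) φ]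
    with x h1 h2 h3
  rw [h1, h3]
  by_cases h : x ∈ S <;> by_cases h' : x ∈ T <;> simp [h, h', h2]

theorem projOp_self {S : Set ℝ} (hS : MeasurableSet S) (φ : H) :
    projOp S hS (projOp S hS φ) = projOp S hS φ := by
  simp [projOp_projOp]

theorem projOp_eq_self {S : Set ℝ} (hS : MeasurableSet S) {φ : H}
    (h : ∀ᵐ x, x ∉ S → φ x = 0) : projOp S hS φ = φ := by
  refine Lp.ext ?_
  filter_upwards [projOp_coe hS φ, h] with x h1 h2
  rw [h1]
  by_cases hx : x ∈ S
  · simp [hx]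
  · simp [hx, h2 hx]

theorem projOp_projOp_of_disjoint {S T : Set ℝ} (hS : MeasurableSet S) (hT : MeasurableSet T)
    (h : Disjoint S T) (φ : H) : projOp S hS (projOp T hT φ) = 0 := by
  refine Lp.ext ?_
  filter_upwards [projOp_coe hS (projOp T hT φ), projOp_coe hT φ, Lp.coeFn_zero ℂ 2 volume]
    with x h1 h2 h3
  rw [h1, h3]
  by_cases hx : x ∈ S
  · simp [hx, h2, Set.disjoint_left.mp h hx]
  · simp [hx]

theorem sum_projOp {S T : Set ℝ} (hS : MeasurableSet S) (hT : MeasurableSet T)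
    (h : Disjoint S T) (φ : H) :
    projOp S hS φ + projOp T hT φ + projOp (S ∪ T)ᶜ (hS.union hT).compl φ = φ := by
  refine Lp.ext ?_
  filter_upwards [Lp.coeFn_add (projOp S hS φ + projOp T hT φ)
      (projOp (S ∪ T)ᶜ (hS.union hT).compl φ), Lp.coeFn_add (projOp S hS φ) (projOp T hT φ),
    projOp_coe hS φ, projOp_coe hT φ, projOp_coe (hS.union hT).compl φ] with x h1 h2 h3 h4 h5
  rw [h1, Pi.add_apply, h2, Pi.add_apply, h3, h4, h5]
  by_cases hx : x ∈ S
  · simp [hx, Set.disjoint_left.mp h hx]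
  · by_cases hy : x ∈ T <;> simp [hx, hy]

theorem adjoint_transOp_transOp (a : ℝ) (φ : H) : (transOp a).adjoint (transOp a φ) = φ := by
  refine ext_inner_left ℂ fun v => ?_
  rw [ContinuousLinearMap.adjoint_inner_right]
  exact LinearIsometry.inner_map_map _ v φ

/-! ### Covariance of projections, translations and instruments -/

theorem isDephasingCovariant_projOp (ħ : ℝ) (μ : Measure ℝ) [IsProbabilityMeasure μ]
    {S : Set ℝ} (hS : MeasurableSet S) : IsDephasingCovariant ħ μ (krausMap (projOp S hS)) :=
  isDephasingCovariant_krausMap ħ μ fun p => ⟨1, by simp, by rw [one_smul, kick_comp_projOp]⟩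

theorem isDephasingCovariant_transOp (ħ : ℝ) (μ : Measure ℝ) [IsProbabilityMeasure μ] (a : ℝ) :
    IsDephasingCovariant ħ μ (krausMap (transOp a)) :=
  isDephasingCovariant_krausMap ħ μ fun p =>
    ⟨kickFun ħ p a, norm_kickFun ħ p a, kick_comp_transOp ħ p a⟩

theorem isDephasingCovariant_transOp_comp_projOp (ħ : ℝ) (μ : Measure ℝ)
    [IsProbabilityMeasure μ] (a : ℝ) {S : Set ℝ} (hS : MeasurableSet S) :
    IsDephasingCovariant ħ μ (krausMap (transOp a ∘L projOp S hS)) := by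
  refine isDephasingCovariant_krausMap ħ μ fun p => ⟨kickFun ħ p a, norm_kickFun ħ p a, ?_⟩
  rw [← ContinuousLinearMap.comp_assoc, kick_comp_transOp, ContinuousLinearMap.smul_comp,
    ContinuousLinearMap.comp_assoc, kick_comp_projOp, ContinuousLinearMap.comp_assoc]

theorem IsDephasingCovariant.apply {ħ : ℝ} {μ : Measure ℝ} [IsProbabilityMeasure μ]
    {Λ : TraceClass →ₗ[ℂ] TraceClass} (h : IsDephasingCovariant ħ μ Λ) (T : TraceClass) :
    dephase ħ μ (Λ T) = Λ (dephase ħ μ T) := (LinearMap.congr_fun h T).symm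

theorem isDephasingCovariant_sum {ħ : ℝ} {μ : Measure ℝ} [IsProbabilityMeasure μ] {n : ℕ}
    {Λ : Fin n → (TraceClass →ₗ[ℂ] TraceClass)} (h : ∀ k, IsDephasingCovariant ħ μ (Λ k)) :
    IsDephasingCovariant ħ μ (∑ k, Λ k) := by
  ext T : 1
  simp only [LinearMap.comp_apply, LinearMap.sum_apply, map_sum, (h _).apply]

theorem isDIOInstrument_krausMap {ħ : ℝ} {μ : Measure ℝ} [IsProbabilityMeasure μ] {n : ℕ}
    {K : Fin n → (H →L[ℂ] H)} (hc : ∀ k, IsDephasingCovariant ħ μ (krausMap (K k)))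
    (hK : ∑ j, (K j).adjoint ∘L K j = ContinuousLinearMap.id ℂ H) :
    IsDIOInstrument ħ μ fun k => krausMap (K k) where
  completelyPositive k := isCompletelyPositive_krausMap (K k)
  covariant := hc
  sum_isDIO := ⟨isCompletelyPositive_sum fun k => isCompletelyPositive_krausMap (K k),
    isTracePreserving_sum_krausMap hK, isDephasingCovariant_sum hc⟩

/-! ### Loss of localized operators -/

theorem l2Loss_krausMap_transOp (ħ : ℝ) (μ : Measure ℝ) [IsProbabilityMeasure μ] (a : ℝ)
    (T : TraceClass) : l2Loss ħ μ (krausMap (transOp a) T) = l2Loss ħ μ T := by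
  rw [l2Loss, (isDephasingCovariant_transOp ħ μ a).apply,
    hsNormSq_krausMap_of_isometry (norm_transOp a), hsNormSq_krausMap_of_isometry (norm_transOp a),
    l2Loss]

/-- This quadratic scaling is the source of the counterexample. -/
theorem l2Loss_smul (ħ : ℝ) (μ : Measure ℝ) [IsProbabilityMeasure μ] (c : ℂ) (T : TraceClass) :
    l2Loss ħ μ (c • T) = ‖c‖ ^ 2 * l2Loss ħ μ T := by
  rw [l2Loss, map_smul, hsNormSq_smul, hsNormSq_smul, l2Loss, mul_sub]

/-- Compression to `A` or `B` commutes with dephasing, so the dephased operators stay localized in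
the disjoint sets. Ranges are then orthogonal and Pythagoras applies both before and after
dephasing. -/
theorem l2Loss_add_of_disjoint (ħ : ℝ) (μ : Measure ℝ) [IsProbabilityMeasure μ] {A B : Set ℝ}
    (hA : MeasurableSet A) (hB : MeasurableSet B) (h : Disjoint A B) {S T : TraceClass}
    (hS : krausMap (projOp A hA) S = S) (hT : krausMap (projOp B hB) T = T) :
    l2Loss ħ μ (S + T) = l2Loss ħ μ S + l2Loss ħ μ T := by
  -- Stated for arbitrary localized operators because it is used for the pair itself and for its
  -- dephased image.
  have key : ∀ {S T : TraceClass}, krausMap (projOp A hA) S = S → krausMap (projOp B hB) T = T →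
      hsNormSq (S + T) = hsNormSq S + hsNormSq T := by
    intro S T hS hT
    refine hsNormSq_add_of_orthogonal fun v => ?_
    rw [← hS, ← hT, krausMap_apply, krausMap_apply, ← ContinuousLinearMap.adjoint_inner_right,
      adjoint_projOp, projOp_projOp_of_disjoint hA hB h, inner_zero_right]
  rw [l2Loss, map_add, key hS hT, key, l2Loss, l2Loss]
  · ring
  · rw [← (isDephasingCovariant_projOp ħ μ hA).apply, hS]
  · rw [← (isDephasingCovariant_projOp ħ μ hB).apply, hT]

/-! ### The instrument acting on the two-packet mixture -/

namespace IsPacketPair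

variable {φ : H} {C : Set ℝ} {a b : ℝ}

theorem projOp_shift_transOp (h : IsPacketPair φ C a b) (c : ℝ) :
    projOp (shift C c) (measurableSet_shift h.measurable c) (transOp c φ) = transOp c φ := by
  refine projOp_eq_self _ ?_
  filter_upwards [transOp_coe c φ, ae_sub_right h.vanish c] with x h1 h2 hx
  rw [h1, h2 hx]

theorem sum_adjoint_packetKraus (h : IsPacketPair φ C a b) :
    ∑ j, (packetKraus C h.measurable a b j).adjoint ∘L packetKraus C h.measurable a b j =
      ContinuousLinearMap.id ℂ H := by
  ext1 v
  simp only [Fin.sum_univ_three, packetKraus, Matrix.cons_val, ContinuousLinearMap.adjoint_comp,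
    add_apply, ContinuousLinearMap.coe_comp, Function.comp_apply, adjoint_transOp_transOp,
    adjoint_projOp, projOp_self, ContinuousLinearMap.id_apply]
  exact sum_projOp _ _ h.disjoint v

theorem isDIOInstrument (h : IsPacketPair φ C a b) (ħ : ℝ) (μ : Measure ℝ)
    [IsProbabilityMeasure μ] : IsDIOInstrument ħ μ (packetInstrument C h.measurable a b) := by
  refine isDIOInstrument_krausMap (fun k => ?_) h.sum_adjoint_packetKraus
  fin_cases k
  · exact isDephasingCovariant_transOp_comp_projOp ħ μ _ _
  · exact isDephasingCovariant_transOp_comp_projOp ħ μ _ _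
  · exact isDephasingCovariant_projOp ħ μ
      ((measurableSet_shift h.measurable a).union (measurableSet_shift h.measurable b)).compl

theorem trace_ketbra_transOp (h : IsPacketPair φ C a b) (c : ℝ) :
    trace (ketbra (transOp c φ)) = 1 := by
  rw [trace_ketbra, norm_transOp, h.norm_eq_one]
  simp

theorem isState (h : IsPacketPair φ C a b) : IsState (packetMixture φ a b) := by
  have h2 : (0 : ℂ) ≤ 1 / 2 := by
    rw [Complex.le_def]
    norm_num
  refine ⟨?_, ?_⟩
  · exact ((isPositive_rankOne_self _).smul_of_nonneg h2).add
      ((isPositive_rankOne_self _).smul_of_nonneg h2)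
  · rw [packetMixture, trace_add, trace_smul, trace_smul, h.trace_ketbra_transOp,
      h.trace_ketbra_transOp]
    norm_num

theorem projOp_shift_left_transOp_right (h : IsPacketPair φ C a b) :
    projOp (shift C a) (measurableSet_shift h.measurable a) (transOp b φ) = 0 := by
  rw [← h.projOp_shift_transOp b]
  exact projOp_projOp_of_disjoint _ _ h.disjoint _

theorem projOp_shift_right_transOp_left (h : IsPacketPair φ C a b) :
    projOp (shift C b) (measurableSet_shift h.measurable b) (transOp a φ) = 0 := by
  rw [← h.projOp_shift_transOp a]
  exact projOp_projOp_of_disjoint _ _ h.disjoint.symm _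

/-- `K_A` moves `φ_a` back to `φ` and kills `φ_b`, `K_B` does the reverse, and `K_0` kills both. The
indices 0, 1, 2 stand for A, B, 0. -/
theorem packetInstrument_packetMixture (h : IsPacketPair φ C a b) (k : Fin 3) :
    packetInstrument C h.measurable a b k (packetMixture φ a b) =
      (![1 / 2, 1 / 2, 0] : Fin 3 → ℂ) k • ketbra φ := by
  rw [packetMixture, map_add, map_smul, map_smul, packetInstrument, krausMap_ketbra,
    krausMap_ketbra]
  fin_cases k
  · simp [packetKraus, h.projOp_shift_transOp, h.projOp_shift_left_transOp_right,
      transOp_neg_transOp, ketbra_zero]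
  · simp [packetKraus, h.projOp_shift_transOp, h.projOp_shift_right_transOp_left,
      transOp_neg_transOp, ketbra_zero]
  · have ha := projOp_projOp_of_disjoint
      ((measurableSet_shift h.measurable a).union (measurableSet_shift h.measurable b)).compl
      (measurableSet_shift h.measurable a)
      (Set.disjoint_compl_left_iff_subset.mpr Set.subset_union_left) (transOp a φ)
    have hb := projOp_projOp_of_disjoint
      ((measurableSet_shift h.measurable a).union (measurableSet_shift h.measurable b)).compl
      (measurableSet_shift h.measurable b)
      (Set.disjoint_compl_left_iff_subset.mpr Set.subset_union_right) (transOp b φ)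
    rw [h.projOp_shift_transOp] at ha hb
    simp [packetKraus, ha, hb, ketbra_zero, -Set.compl_union]

theorem branchProb_packetInstrument (h : IsPacketPair φ C a b) (k : Fin 3) :
    branchProb (packetInstrument C h.measurable a b k) (packetMixture φ a b) =
      (![1 / 2, 1 / 2, 0] : Fin 3 → ℝ) k := by
  rw [branchProb, h.packetInstrument_packetMixture, trace_smul, trace_ketbra, h.norm_eq_one]
  fin_cases k <;> simp

theorem branchState_packetInstrument (h : IsPacketPair φ C a b) {k : Fin 3} (hk : k ≠ 2) :
    branchState (packetInstrument C h.measurable a b k) (packetMixture φ a b) = ketbra φ := by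
  rw [branchState, h.branchProb_packetInstrument, h.packetInstrument_packetMixture, smul_smul]
  fin_cases k
  · simp
  · simp
  · exact absurd rfl hk

theorem averageAfter_packetInstrument (h : IsPacketPair φ C a b) (F : TraceClass → ℝ) :
    averageAfter F (packetInstrument C h.measurable a b) (packetMixture φ a b) = F (ketbra φ) := by
  rw [averageAfter, Fin.sum_univ_three, h.branchState_packetInstrument (k := 0) (by decide),
    h.branchState_packetInstrument (k := 1) (by decide), h.branchProb_packetInstrument,
    h.branchProb_packetInstrument, h.branchProb_packetInstrument]
  simp only [Matrix.cons_val]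
  ring

theorem l2Loss_packetMixture (h : IsPacketPair φ C a b) (ħ : ℝ) (μ : Measure ℝ)
    [IsProbabilityMeasure μ] :
    l2Loss ħ μ (packetMixture φ a b) = 1 / 2 * l2Loss ħ μ (ketbra φ) := by
  -- The factor is `|1/2|²` times two equal losses.
  rw [packetMixture, ← smul_add, l2Loss_smul,
    l2Loss_add_of_disjoint ħ μ (measurableSet_shift h.measurable a)
      (measurableSet_shift h.measurable b) h.disjoint, ← krausMap_ketbra, ← krausMap_ketbra,
    l2Loss_krausMap_transOp, l2Loss_krausMap_transOp]
  · norm_num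
    ring
  · rw [krausMap_ketbra, h.projOp_shift_transOp]
  · rw [krausMap_ketbra, h.projOp_shift_transOp]

end IsPacketPair

/-! ### Strict loss for non-degenerate kicks -/

/-- Orthonormal vectors lie at distance `√2`, so balls of radius ½ around them are disjoint open
sets. -/
theorem _root_.Orthonormal.countable_of_separableSpace {ι 𝕜 E : Type*} [RCLike 𝕜]
    [NormedAddCommGroup E] [InnerProductSpace 𝕜 E] [TopologicalSpace.SeparableSpace E]
    {v : ι → E} (hv : Orthonormal 𝕜 v) : Countable ι := by
  have hd : Pairwise (Function.onFun Disjoint fun i => Metric.ball (v i) (1 / 2)) := by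
    intro i j hij
    refine Metric.ball_disjoint_ball ?_
    have h1 : ‖v i - v j‖ ^ 2 = 2 := by
      rw [@norm_sub_sq 𝕜, hv.1, hv.1, hv.2 hij]
      norm_num
    rw [dist_eq_norm]
    nlinarith [norm_nonneg (v i - v j)]
  exact hd.countable_of_isOpen_disjoint (fun _ => Metric.isOpen_ball)
    fun i => ⟨v i, Metric.mem_ball_self (by norm_num)⟩

/-- Countability permits exchanging the basis sum with an integral over `μ`. -/
instance : Countable basisIndex := by
  have : Fact ((2 : ℝ≥0∞) ≠ ∞) := ⟨by norm_num⟩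
  exact basis.orthonormal.countable_of_separableSpace

theorem isProbabilityMeasure_eq_dirac_of_compl_eq_zero (μ : Measure ℝ) [IsProbabilityMeasure μ]
    {p : ℝ} (h : μ {p}ᶜ = 0) : μ = Measure.dirac p := by
  have h1 : μ {p} = 1 := (prob_compl_eq_zero_iff (measurableSet_singleton p)).mp h
  ext s hs
  rw [Measure.dirac_apply' p hs]
  by_cases hp : p ∈ s
  · rw [Set.indicator_of_mem hp, Pi.one_apply]
    refine le_antisymm prob_le_one ?_
    rw [← h1]
    exact measure_mono (Set.singleton_subset_iff.mpr hp)
  · rw [Set.indicator_of_notMem hp]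
    exact measure_mono_null (fun x hx (hxp : x = p) => hp (hxp ▸ hx)) h

/-- A function bounded by one that is smaller than one on a non-null set has mean below one. -/
theorem integral_lt_one {μ : Measure ℝ} [IsProbabilityMeasure μ] {f : ℝ → ℝ}
    (hf : Integrable f μ) (h1 : ∀ x, f x ≤ 1) (h2 : μ {x | f x < 1} ≠ 0) : ∫ x, f x ∂μ < 1 := by
  have hpos : 0 < ∫ x, (1 - f x) ∂μ := by
    rw [integral_pos_iff_support_of_nonneg (fun x => sub_nonneg.mpr (h1 x))
      ((integrable_const 1).sub hf)]
    refine (pos_iff_ne_zero.mpr h2).trans_le (measure_mono fun x hx => ?_)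
    exact (sub_pos.mpr hx).ne'
  rw [integral_sub (integrable_const 1) hf] at hpos
  simpa using hpos

/-! ### Purity of a dephased pure state -/

theorem inner_dephase_ketbra (ħ : ℝ) (μ : Measure ℝ) [IsProbabilityMeasure μ] (φ u v : H) :
    inner ℂ u ((dephase ħ μ (ketbra φ) : H →L[ℂ] H) v) =
      ∫ p, inner ℂ u (kick ħ p φ) * inner ℂ (kick ħ p φ) v ∂μ := by
  rw [dephase_coe, dephaseBounded_apply, ← integral_inner (integrable_kick_conj ħ μ _ v)]
  refine integral_congr_ae (Filter.Eventually.of_forall fun p => ?_)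
  simp [ketbra, inner_smul_right, ContinuousLinearMap.adjoint_inner_right, mul_comm]

theorem dephase_ketbra_symm (ħ : ℝ) (μ : Measure ℝ) [IsProbabilityMeasure μ] (φ u v : H) :
    inner ℂ ((dephase ħ μ (ketbra φ) : H →L[ℂ] H) u) v =
      inner ℂ u ((dephase ħ μ (ketbra φ) : H →L[ℂ] H) v) := by
  rw [← inner_conj_symm, inner_dephase_ketbra, inner_dephase_ketbra, ← integral_conj]
  refine integral_congr_ae (Filter.Eventually.of_forall fun p => ?_)
  simp [mul_comm]

/-- With `S = ∫ |φ_p⟩⟨φ_p| dμ(p)` self-adjoint, the left side is `Tr S²`. Expanding one factor `S`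
and summing over the basis gives `∫ ⟨φ_p, S φ_p⟩ dμ(p)`; expanding the other gives the double
integral. -/
theorem hsNormSq_dephase_ketbra (ħ : ℝ) (μ : Measure ℝ) [IsProbabilityMeasure μ] (φ : H) :
    hsNormSq (dephase ħ μ (ketbra φ)) =
      ∫ p, ∫ q, ‖inner ℂ (kick ħ p φ) (kick ħ q φ)‖ ^ 2 ∂μ ∂μ := by
  set S : H →L[ℂ] H := (dephase ħ μ (ketbra φ) : H →L[ℂ] H) with hS
  have hc := continuous_kick ħ φ
  -- Parseval under the integral sign. The dominating series has sum at most `‖φ_p‖ ‖S φ_p‖`, which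
  -- is bounded uniformly in `p` since kicks preserve norms.
  have h1 : HasSum (fun i => ∫ p, inner ℂ (kick ħ p φ) (basis i) *
      inner ℂ (basis i) (S (kick ħ p φ)) ∂μ) (∫ p, inner ℂ (kick ħ p φ) (S (kick ħ p φ)) ∂μ) := by
    refine hasSum_integral_of_dominated_convergence
      (fun i p => ‖inner ℂ (kick ħ p φ) (basis i)‖ * ‖inner ℂ (basis i) (S (kick ħ p φ))‖)
      (fun i => ?_) (fun i => ?_) ?_ ?_ ?_
    · exact (by fun_prop : Continuous fun p => inner ℂ (kick ħ p φ) (basis i : H) *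
        inner ℂ (basis i : H) (S (kick ħ p φ))).aestronglyMeasurable
    · exact Filter.Eventually.of_forall fun p => (norm_mul _ _).le
    · exact Filter.Eventually.of_forall fun p => (summable_norm_inner_mul_norm_inner _ _).1
    · refine Integrable.of_bound (C := ‖φ‖ * (‖S‖ * ‖φ‖)) ?_ (Filter.Eventually.of_forall fun p => ?_)
      · refine (Measurable.aestronglyMeasurable ?_)
        refine Measurable.tsum fun i => ?_
        exact (by fun_prop : Continuous fun p => ‖inner ℂ (kick ħ p φ) (basis i : H)‖ *
          ‖inner ℂ (basis i : H) (S (kick ħ p φ))‖).measurable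
      · rw [Real.norm_of_nonneg (tsum_nonneg fun _ => by positivity)]
        refine (summable_norm_inner_mul_norm_inner _ _).2.trans ?_
        rw [norm_kick]
        gcongr
        rw [← norm_kick ħ p φ]
        exact S.le_opNorm _
    · exact Filter.Eventually.of_forall fun p => basis.hasSum_inner_mul_inner _ _
  have h2 : ∀ i, ∫ p, inner ℂ (kick ħ p φ) (basis i) * inner ℂ (basis i) (S (kick ħ p φ)) ∂μ =
      ((‖S (basis i)‖ ^ 2 : ℝ) : ℂ) := by
    intro i
    rw [Complex.ofReal_pow]
    refine Eq.trans ?_ (inner_self_eq_norm_sq_to_K (𝕜 := ℂ) (S (basis i)))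
    rw [inner_dephase_ketbra]
    refine integral_congr_ae (Filter.Eventually.of_forall fun p => ?_)
    simp only
    rw [dephase_ketbra_symm, mul_comm]
  have h3 : ∀ p, inner ℂ (kick ħ p φ) (S (kick ħ p φ)) =
      ((∫ q, ‖inner ℂ (kick ħ p φ) (kick ħ q φ)‖ ^ 2 ∂μ : ℝ) : ℂ) := by
    intro p
    rw [inner_dephase_ketbra, ← integral_complex_ofReal]
    refine integral_congr_ae (Filter.Eventually.of_forall fun q => ?_)
    simp only
    rw [← inner_conj_symm (kick ħ q φ), Complex.mul_conj', Complex.ofReal_pow]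
  simp_rw [h2, h3] at h1
  rw [integral_complex_ofReal] at h1
  exact (Complex.hasSum_ofReal.mp h1).tsum_eq

theorem norm_inner_kick_le (ħ : ℝ) {φ : H} (hφ : ‖φ‖ = 1) (p q : ℝ) :
    ‖inner ℂ (kick ħ p φ) (kick ħ q φ)‖ ^ 2 ≤ 1 := by
  have h := norm_inner_le_norm (𝕜 := ℂ) (kick ħ p φ) (kick ħ q φ)
  rw [norm_kick, norm_kick, hφ, mul_one] at h
  exact pow_le_one₀ (norm_nonneg _) h

/-- The loss is one minus the mean overlap. Since `μ ≠ δ_p`, the points `q ≠ p` have positive mass,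
so each inner average is strictly below one, and hence so is the outer one. -/
theorem l2Loss_ketbra_pos {ħ : ℝ} {μ : Measure ℝ} [IsProbabilityMeasure μ]
    (hμ : ∀ p, μ ≠ Measure.dirac p) {φ : H} (hφ : ‖φ‖ = 1)
    (h : ∀ p q, p ≠ q → ‖inner ℂ (kick ħ p φ) (kick ħ q φ)‖ ^ 2 < 1) :
    0 < l2Loss ħ μ (ketbra φ) := by
  rw [l2Loss, hsNormSq_ketbra, hφ, hsNormSq_dephase_ketbra, sub_pos]
  have hc : Continuous fun z : ℝ × ℝ => ‖inner ℂ (kick ħ z.1 φ) (kick ħ z.2 φ)‖ ^ 2 := by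
    have h1 := (continuous_kick ħ φ).comp (continuous_fst (X := ℝ) (Y := ℝ))
    have h2 := (continuous_kick ħ φ).comp (continuous_snd (X := ℝ) (Y := ℝ))
    exact ((h1.inner h2).norm).pow 2
  have hint : Integrable (fun z : ℝ × ℝ => ‖inner ℂ (kick ħ z.1 φ) (kick ħ z.2 φ)‖ ^ 2)
      (μ.prod μ) :=
    Integrable.of_bound hc.aestronglyMeasurable 1 (Filter.Eventually.of_forall fun z => by
      rw [Real.norm_of_nonneg (by positivity)]
      exact norm_inner_kick_le ħ hφ _ _)
  have hinner : ∀ p, ∫ q, ‖inner ℂ (kick ħ p φ) (kick ħ q φ)‖ ^ 2 ∂μ < 1 := by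
    intro p
    refine integral_lt_one ?_ (norm_inner_kick_le ħ hφ p) fun h0 => ?_
    · refine Integrable.of_bound (hc.comp (Continuous.prodMk_right p)).aestronglyMeasurable 1
        (Filter.Eventually.of_forall fun q => ?_)
      rw [Real.norm_of_nonneg (by positivity)]
      exact norm_inner_kick_le ħ hφ _ _
    · refine hμ p (isProbabilityMeasure_eq_dirac_of_compl_eq_zero μ ?_)
      exact measure_mono_null (fun q hq => h p q fun hpq => hq hpq.symm) h0
  have hlt := integral_lt_one hint.integral_prod_left (fun p => (hinner p).le) (by
    simp [hinner])
  simpa using hlt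

/-- Distinct momentum kicks take a wave function to non-parallel ones. -/
theorem norm_inner_kick_lt {ħ : ℝ} (hħ : 0 < ħ) {φ : H} (hφ : ‖φ‖ = 1) {p q : ℝ} (hpq : p ≠ q) :
    ‖inner ℂ (kick ħ p φ) (kick ħ q φ)‖ ^ 2 < 1 := by
  refine lt_of_le_of_ne (norm_inner_kick_le ħ hφ p q) fun h => ?_
  have hn : ‖inner ℂ (kick ħ p φ) (kick ħ q φ)‖ = ‖kick ħ p φ‖ * ‖kick ħ q φ‖ := by
    rw [norm_kick, norm_kick, hφ, mul_one]
    exact (pow_eq_one_iff_of_nonneg (norm_nonneg _) two_ne_zero).mp h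
  have h0 : ∀ r, kick ħ r φ ≠ 0 := fun r => by
    rw [← norm_ne_zero_iff, norm_kick, hφ]
    exact one_ne_zero
  -- Equality in Cauchy-Schwarz makes the two kicked vectors proportional, so `e^{iθx} = c` almost
  -- everywhere on the set where `φ ≠ 0`.
  obtain ⟨c, -, hc⟩ := (norm_inner_eq_norm_iff (h0 p) (h0 q)).mp hn
  have hθ : (q - p) / ħ ≠ 0 := div_ne_zero (sub_ne_zero.mpr hpq.symm) hħ.ne'
  set θ := (q - p) / ħ with hθdef
  -- As `θ ≠ 0`, this set is empty or contained in a progression of step `2π/θ`; being countable it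
  -- is null, which forces `φ = 0`.
  have hcount : {x : ℝ | Complex.exp ((θ * x : ℝ) * Complex.I) = c}.Countable := by
    rcases Set.eq_empty_or_nonempty {x : ℝ | Complex.exp ((θ * x : ℝ) * Complex.I) = c}
      with he | ⟨y, hy⟩
    · rw [he]
      exact Set.countable_empty
    · refine (Set.countable_range fun n : ℤ => y + n * (2 * Real.pi) / θ).mono fun x hx => ?_
      obtain ⟨n, hn⟩ := Complex.exp_eq_exp_iff_exists_int.mp
        ((show Complex.exp ((θ * x : ℝ) * Complex.I) = c from hx).trans hy.symm)
      have h1 : ((θ * x : ℝ) : ℂ) = ((θ * y + n * (2 * Real.pi) : ℝ) : ℂ) := by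
        refine mul_right_cancel₀ Complex.I_ne_zero ?_
        rw [hn]
        push_cast
        ring
      refine ⟨n, ?_⟩
      have h2 := Complex.ofReal_injective h1
      simp only
      field_simp
      linarith
  have hzero : φ = 0 := by
    refine Lp.ext ?_
    have hk := Lp.coeFn_smul c (kick ħ p φ)
    rw [← hc] at hk
    filter_upwards [hk, kick_coe ħ p φ, kick_coe ħ q φ, Lp.coeFn_zero ℂ 2 volume,
      hcount.ae_notMem volume] with x h1 h2 h3 h4 h5
    rw [h4, Pi.zero_apply]
    by_contra hx
    rw [h3, Pi.smul_apply, h2, smul_eq_mul, ← mul_assoc] at h1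
    have h6 := mul_right_cancel₀ hx h1
    refine h5 ?_
    have hkp : kickFun ħ p x ≠ 0 := Complex.exp_ne_zero _
    refine mul_right_cancel₀ hkp (Eq.trans ?_ h6)
    rw [kickFun, kickFun, ← Complex.exp_add]
    congr 1
    push_cast [hθdef]
    ring
  rw [hzero, norm_zero] at hφ
  exact zero_ne_one hφ

/-- The half-open unit interval is disjoint from its translate by one. -/
theorem exists_isPacketPair : ∃ (φ : H) (C : Set ℝ) (a b : ℝ), IsPacketPair φ C a b := by
  have hv : (volume : Measure ℝ) (Set.Ico 0 1) ≠ ∞ := by simp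
  refine ⟨indicatorConstLp 2 measurableSet_Ico hv (1 : ℂ), Set.Ico 0 1, 0, 1, ?_,
    measurableSet_Ico, Metric.isBounded_Ico 0 1, ?_, ?_⟩
  · rw [norm_indicatorConstLp (by norm_num) (by norm_num)]
    simp
  · filter_upwards [indicatorConstLp_coeFn (p := 2) (hs := measurableSet_Ico) (hμs := hv)
      (c := (1 : ℂ))] with x hx hxC
    rw [hx, Set.indicator_of_notMem hxC]
  · rw [Set.disjoint_left]
    rintro x ⟨-, h1⟩ ⟨h2, -⟩
    linarith

end PositionCoherence
end

theorem mainTheorem5 (ħ : ℝ) (hħ : 0 < ħ) (μ : MeasureTheory.Measure ℝ)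
    [MeasureTheory.IsProbabilityMeasure μ]
    (hμ : ∀ p : ℝ, μ ≠ MeasureTheory.Measure.dirac p) :
    ¬ IsStronglyMonotone ħ μ (l2Loss ħ μ) ∧
    (∃ (φ : H) (C : Set ℝ) (a b : ℝ), IsPacketPair φ C a b ∧ 0 < l2Loss ħ μ (ketbra φ)) ∧
    ∀ (φ : H) (C : Set ℝ) (a b : ℝ) (h : IsPacketPair φ C a b),
      (∑ j, (packetKraus C h.measurable a b j).adjoint ∘L packetKraus C h.measurable a b j =
        ContinuousLinearMap.id ℂ H) ∧
      IsDIOInstrument ħ μ (packetInstrument C h.measurable a b) ∧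
      IsState (packetMixture φ a b) ∧
      branchProb (packetInstrument C h.measurable a b 0) (packetMixture φ a b) = 1 / 2 ∧
      branchProb (packetInstrument C h.measurable a b 1) (packetMixture φ a b) = 1 / 2 ∧
      branchProb (packetInstrument C h.measurable a b 2) (packetMixture φ a b) = 0 ∧
      branchState (packetInstrument C h.measurable a b 0) (packetMixture φ a b) = ketbra φ ∧
      branchState (packetInstrument C h.measurable a b 1) (packetMixture φ a b) = ketbra φ ∧
      averageAfter (l2Loss ħ μ) (packetInstrument C h.measurable a b) (packetMixture φ a b) =
        l2Loss ħ μ (ketbra φ) ∧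
      l2Loss ħ μ (packetMixture φ a b) = 1 / 2 * l2Loss ħ μ (ketbra φ) ∧
      (0 < l2Loss ħ μ (ketbra φ) →
        l2Loss ħ μ (packetMixture φ a b) <
          averageAfter (l2Loss ħ μ) (packetInstrument C h.measurable a b)
            (packetMixture φ a b)) := by
  -- Positivity holds for every admissible `φ`, so any packet pair is a counterexample.
  have hpos : ∀ {φ : H} {C : Set ℝ} {a b : ℝ}, IsPacketPair φ C a b →
      0 < l2Loss ħ μ (ketbra φ) := fun h =>
    l2Loss_ketbra_pos hμ h.norm_eq_one fun _ _ => norm_inner_kick_lt hħ h.norm_eq_one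
  obtain ⟨φ₀, C₀, a₀, b₀, h₀⟩ := exists_isPacketPair
  refine ⟨fun hmono => ?_, ⟨φ₀, C₀, a₀, b₀, h₀, hpos h₀⟩, fun φ C a b h => ?_⟩
  · have h1 := hmono 3 _ (h₀.isDIOInstrument ħ μ) _ h₀.isState
    rw [h₀.averageAfter_packetInstrument, h₀.l2Loss_packetMixture] at h1
    linarith [hpos h₀]
  · refine ⟨h.sum_adjoint_packetKraus, h.isDIOInstrument ħ μ, h.isState,
      h.branchProb_packetInstrument 0, h.branchProb_packetInstrument 1,
      h.branchProb_packetInstrument 2, h.branchState_packetInstrument (by decide),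
      h.branchState_packetInstrument (by decide), h.averageAfter_packetInstrument _,
      h.l2Loss_packetMixture ħ μ, fun h1 => ?_⟩
    rw [h.averageAfter_packetInstrument, h.l2Loss_packetMixture]
    linarith
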